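/- Let $M$ be a closed (compact, boundaryless) connected smooth Riemannian manifold. For $h\in H_1(M;\mathbb{R})$ let $$\|h\|:=\inf\Big\{\sum_{i=1}^{m}|r_i|\,\ell(\sigma_i)\Big\}$$ be the stable norm, where the infimum is taken over all real Lipschitz $1$-cycles $\sum_{i=1}^m r_i\sigma_i$ (finite real combinations of Lipschitz singular $1$-simplices $\sigma_i$ with zero boundary) representing $h$, and $\ell$ denotes length. Let $\mathcal{B}(M)=\{h\in H_1(M;\mathbb{R}) : \|h\|\le 1\}$ be its unit ball. Let $i:H_1(M;\mathbb{Z})\to H_1(M;\mathbb{R})$ be the map induced by the inclusion $\mathbb{Z}\hookrightarrow\mathbb{R}$ of coefficients, and let $\mu$ be the Haar measure on the finite-dimensional real vector space $H_1(M;\mathbb{R})$ for which a fundamental domain (equivalently, a fundamental parallelepiped) of the lattice $i(H_1(M;\mathbb{Z}))$ has measure $1$. If $\gamma_1,\dots,\gamma_d$ are closed geodesics of $M$ whose homology classes form a basis of $H_1(M;\mathbb{R})$, then $$\mu(\mathcal{B}(M))\cdot\prod_{k=1}^{d}\ell(\gamma_k)\;\ge\;\frac{2^d}{d!}.$$ 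-/

import Mathlib

open MeasureTheory Set
open scoped ENNReal NNReal Manifold ContDiff Bundle

noncomputable section

/-! ### Singular homology in degree one, with coefficients in a commutative ring -/

section Homology

/-- Singular `n`-simplices of `M`. -/
abbrev SingularSimplex (M : Type*) [TopologicalSpace M] (n : ℕ) : Type _ :=
  C(stdSimplex ℝ (Fin (n + 1)), M)

/-- The `i`-th face of a singular simplex. -/
def SingularSimplex.face {M : Type*} [TopologicalSpace M] {n : ℕ} (i : Fin (n + 2))
    (σ : SingularSimplex M (n + 1)) : SingularSimplex M n :=
  σ.comp ⟨stdSimplex.map i.succAbove, stdSimplex.continuous_map _⟩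

/-- Singular `n`-chains: formal finite linear combinations of singular `n`-simplices. -/
abbrev SingularChain (R : Type*) [CommRing R] (M : Type*) [TopologicalSpace M] (n : ℕ) : Type _ :=
  SingularSimplex M n →₀ R

/-- The boundary operator `∂ σ = ∑ i, (-1) ^ i • (i-th face of σ)`. -/
def singularBoundary (R : Type*) [CommRing R] (M : Type*) [TopologicalSpace M] (n : ℕ) :
    SingularChain R M (n + 1) →ₗ[R] SingularChain R M n :=
  ∑ i : Fin (n + 2), (-1 : R) ^ (i : ℕ) • Finsupp.lmapDomain R R (SingularSimplex.face i)

/-- Singular `1`-cycles. -/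
def singularCycles₁ (R : Type*) [CommRing R] (M : Type*) [TopologicalSpace M] :
    Submodule R (SingularChain R M 1) :=
  LinearMap.ker (singularBoundary R M 0)

/-- The module of singular `1`-cycles. -/
def SingularCycle₁ (R : Type*) [CommRing R] (M : Type*) [TopologicalSpace M] : Type _ :=
  singularCycles₁ R M

instance (R : Type*) [CommRing R] (M : Type*) [TopologicalSpace M] :
    AddCommGroup (SingularCycle₁ R M) :=
  inferInstanceAs (AddCommGroup (singularCycles₁ R M))

instance (R : Type*) [CommRing R] (M : Type*) [TopologicalSpace M] :
    Module R (SingularCycle₁ R M) :=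
  inferInstanceAs (Module R (singularCycles₁ R M))

/-- The chain underlying a `1`-cycle. -/
def SingularCycle₁.chain (R : Type*) [CommRing R] (M : Type*) [TopologicalSpace M] :
    SingularCycle₁ R M →ₗ[R] SingularChain R M 1 :=
  (singularCycles₁ R M).subtype

/-- Boundaries of singular `2`-chains, inside the module of `1`-cycles. -/
def singularBoundaries₁ (R : Type*) [CommRing R] (M : Type*) [TopologicalSpace M] :
    Submodule R (SingularCycle₁ R M) :=
  (LinearMap.range (singularBoundary R M 1)).comap (SingularCycle₁.chain R M)

/-- The first singular homology module `H₁(M; R)`. -/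
def SingularH₁ (R : Type*) [CommRing R] (M : Type*) [TopologicalSpace M] : Type _ :=
  SingularCycle₁ R M ⧸ singularBoundaries₁ R M

instance (R : Type*) [CommRing R] (M : Type*) [TopologicalSpace M] :
    AddCommGroup (SingularH₁ R M) :=
  inferInstanceAs (AddCommGroup (SingularCycle₁ R M ⧸ singularBoundaries₁ R M))

instance (R : Type*) [CommRing R] (M : Type*) [TopologicalSpace M] :
    Module R (SingularH₁ R M) :=
  inferInstanceAs (Module R (SingularCycle₁ R M ⧸ singularBoundaries₁ R M))

/-- The homology class of a `1`-cycle. -/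
def singularClass (R : Type*) [CommRing R] (M : Type*) [TopologicalSpace M] :
    SingularCycle₁ R M →ₗ[R] SingularH₁ R M :=
  (singularBoundaries₁ R M).mkQ

/-- The map on chains induced by a homomorphism of coefficient rings. -/
def chainCoeffMap {R S : Type*} [CommRing R] [CommRing S] (f : R →+* S) (M : Type*)
    [TopologicalSpace M] (n : ℕ) : SingularChain R M n →+ SingularChain S M n :=
  Finsupp.mapRange.addMonoidHom f.toAddMonoidHom

lemma singularBoundary_chainCoeffMap {R S : Type*} [CommRing R] [CommRing S] (f : R →+* S)
    (M : Type*) [TopologicalSpace M] (n : ℕ) (c : SingularChain R M (n + 1)) :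
    singularBoundary S M n (chainCoeffMap f M (n + 1) c) =
      chainCoeffMap f M n (singularBoundary R M n c) := by
  induction c using Finsupp.induction_linear with
  | zero => simp
  | add a b ha hb => simp only [map_add, ha, hb]
  | single σ r =>
    simp only [singularBoundary, chainCoeffMap, LinearMap.sum_apply, LinearMap.smul_apply,
      Finsupp.lmapDomain_apply, Finsupp.mapDomain_single, Finsupp.mapRange.addMonoidHom_apply,
      Finsupp.mapRange_single, map_sum, Finsupp.smul_single, smul_eq_mul]
    simp

/-- The map on `1`-cycles induced by a homomorphism of coefficient rings. -/
def cycleCoeffMap {R S : Type*} [CommRing R] [CommRing S] (f : R →+* S) (M : Type*)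
    [TopologicalSpace M] : SingularCycle₁ R M →+ SingularCycle₁ S M where
  toFun c := ⟨chainCoeffMap f M 1 (SingularCycle₁.chain R M c), by
    have hc : singularBoundary R M 0 (SingularCycle₁.chain R M c) = 0 := c.2
    rw [singularCycles₁, LinearMap.mem_ker, singularBoundary_chainCoeffMap, hc, map_zero]⟩
  map_zero' := Subtype.ext (by simp only [map_zero]; rfl)
  map_add' a b := Subtype.ext (by simp only [map_add]; rfl)

/-- The map `H₁(M; R) → H₁(M; S)` induced by a homomorphism `R → S` of coefficient rings. -/
def homologyCoeffMap {R S : Type*} [CommRing R] [CommRing S] (f : R →+* S) (M : Type*)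
    [TopologicalSpace M] : SingularH₁ R M →+ SingularH₁ S M :=
  QuotientAddGroup.map (singularBoundaries₁ R M).toAddSubgroup
    (singularBoundaries₁ S M).toAddSubgroup (cycleCoeffMap f M) <| by
    rintro c ⟨b, hb⟩
    exact ⟨chainCoeffMap f M 2 b, by rw [singularBoundary_chainCoeffMap, hb]; rfl⟩

/-- The integer lattice `i(H₁(M; ℤ))` in `H₁(M; ℝ)`. -/
def integerLattice (M : Type*) [TopologicalSpace M] : AddSubgroup (SingularH₁ ℝ M) :=
  (homologyCoeffMap (Int.castRingHom ℝ) M).range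

end Homology

/-! ### The Haar measure on `H₁(M; ℝ)` normalized by the integer lattice -/

section Measure

/-- `H₁(M; ℝ)` carries its canonical vector space topology (the usual one in finite dimension). -/
instance (M : Type*) [TopologicalSpace M] : TopologicalSpace (SingularH₁ ℝ M) :=
  moduleTopology ℝ (SingularH₁ ℝ M)

instance (M : Type*) [TopologicalSpace M] : IsModuleTopology ℝ (SingularH₁ ℝ M) := ⟨rfl⟩

instance (M : Type*) [TopologicalSpace M] : IsTopologicalAddGroup (SingularH₁ ℝ M) :=
  IsModuleTopology.topologicalAddGroup ℝ _

instance (M : Type*) [TopologicalSpace M] : MeasurableSpace (SingularH₁ ℝ M) :=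
  borel _

instance (M : Type*) [TopologicalSpace M] : BorelSpace (SingularH₁ ℝ M) := ⟨rfl⟩

open Classical in
/-- A Haar measure on `H₁(M; ℝ)`, well defined up to a positive factor. (A compact set with
nonempty interior exists whenever `H₁(M; ℝ)` is finite dimensional.) -/
def homologyHaar (M : Type*) [TopologicalSpace M] : Measure (SingularH₁ ℝ M) :=
  if h : Nonempty (TopologicalSpace.PositiveCompacts (SingularH₁ ℝ M)) then
    Measure.addHaarMeasure h.some
  else 0

/-- The Haar measure on `H₁(M; ℝ)` for which a fundamental domain of the integer lattice
`i(H₁(M; ℤ))` has measure one. -/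
def latticeHaar (M : Type*) [TopologicalSpace M] : Measure (SingularH₁ ℝ M) :=
  (addCovolume (integerLattice M) (SingularH₁ ℝ M) (homologyHaar M))⁻¹ • homologyHaar M

end Measure

/-! ### The stable norm -/

section StableNorm

/-- The length of a singular `1`-simplex, as the supremum of the lengths of inscribed polygons. -/
def simplexLength {M : Type*} [PseudoEMetricSpace M] (σ : SingularSimplex M 1) : ℝ≥0∞ :=
  eVariationOn (fun t : unitInterval => σ (stdSimplexHomeomorphUnitInterval.symm t)) univ

/-- The stable norm: the infimum of `∑ |rᵢ| ℓ(σᵢ)` over all real Lipschitz `1`-cycles `∑ rᵢ σᵢ`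
that represent `h`. -/
def stableNorm {M : Type*} [PseudoEMetricSpace M] (h : SingularH₁ ℝ M) : ℝ≥0∞ :=
  ⨅ (c : SingularCycle₁ ℝ M)
    (_ : ∀ σ ∈ (SingularCycle₁.chain ℝ M c).support, ∃ K : ℝ≥0, LipschitzWith K σ)
    (_ : singularClass ℝ M c = h),
    (SingularCycle₁.chain ℝ M c).sum fun σ r => ‖r‖ₑ * simplexLength σ

/-- The unit ball of the stable norm. -/
def stableBall (M : Type*) [PseudoEMetricSpace M] : Set (SingularH₁ ℝ M) :=
  {h | stableNorm h ≤ 1}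

end StableNorm

/-! ### Closed geodesics -/

section Geodesics

/-- A closed geodesic, parametrized with period one: a periodic curve of constant positive speed
that locally realizes the distance. -/
structure ClosedGeodesic (M : Type*) [PseudoEMetricSpace M] where
  /-- the underlying curve -/
  curve : C(ℝ, M)
  periodic : Function.Periodic curve 1
  locally_minimizing : ∃ v : ℝ, 0 < v ∧ ∀ t : ℝ, ∃ ε > 0,
    ∀ s ∈ Ioo (t - ε) (t + ε), ∀ s' ∈ Ioo (t - ε) (t + ε),
      edist (curve s) (curve s') = ENNReal.ofReal (v * |s - s'|)

variable {M : Type*} [PseudoEMetricSpace M]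

/-- The length of a closed geodesic, over one period. -/
def ClosedGeodesic.length (γ : ClosedGeodesic M) : ℝ≥0∞ :=
  eVariationOn γ.curve (Icc 0 1)

/-- A closed geodesic as a singular `1`-simplex. -/
def ClosedGeodesic.simplex (γ : ClosedGeodesic M) : SingularSimplex M 1 :=
  γ.curve.comp ⟨fun x => (x : Fin 2 → ℝ) 1, (continuous_apply (1 : Fin 2)).comp continuous_subtype_val⟩

lemma ClosedGeodesic.single_mem_cycles (R : Type*) [CommRing R] (γ : ClosedGeodesic M) :
    Finsupp.single γ.simplex (1 : R) ∈ singularCycles₁ R M := by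
  have key : SingularSimplex.face (0 : Fin 2) γ.simplex =
      SingularSimplex.face (1 : Fin 2) γ.simplex := by
    ext x
    have h1 : γ.curve 1 = γ.curve 0 := by simpa using γ.periodic 0
    have e0 : ((stdSimplex.map (Fin.succAbove (0 : Fin 2)) x : stdSimplex ℝ (Fin 2)) :
        Fin 2 → ℝ) 1 = 1 := by
      simp [stdSimplex.map_coe, FunOnFinite.linearMap_apply_apply, Finset.filter_singleton]
    have e1 : ((stdSimplex.map (Fin.succAbove (1 : Fin 2)) x : stdSimplex ℝ (Fin 2)) :
        Fin 2 → ℝ) 1 = 0 := by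
      simp [stdSimplex.map_coe, FunOnFinite.linearMap_apply_apply]
    simp only [SingularSimplex.face, ClosedGeodesic.simplex, ContinuousMap.comp_apply,
      ContinuousMap.coe_mk]
    rw [e0, e1, h1]
  rw [singularCycles₁, LinearMap.mem_ker, singularBoundary, LinearMap.sum_apply]
  erw [Fin.sum_univ_two]
  simp only [LinearMap.smul_apply, Finsupp.lmapDomain_apply, Finsupp.mapDomain_single]
  erw [key]
  simp

/-- The homology class in `H₁(M; ℝ)` of a closed geodesic. -/
def ClosedGeodesic.homologyClass (γ : ClosedGeodesic M) : SingularH₁ ℝ M :=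
  singularClass ℝ M ⟨Finsupp.single γ.simplex 1, γ.single_mem_cycles ℝ⟩

end Geodesics

end

/-!
In the coordinates of the basis `[γ₁], …, [γ_d]` of `H₁(M; ℝ)`, the seminorm properties of the
stable norm and `‖[γₖ]‖ ≤ ℓ(γₖ)` put the cross-polytope `{x | ∑ |xₖ| ℓ(γₖ) ≤ 1}` inside the unit
ball; its Lebesgue measure is `2 ^ d / (d! ∏ ℓ(γₖ))`. The classes `[γₖ]` are integral, so they
generate a subgroup of the integer lattice, whose covolume is therefore at most the measure of the
parallelepiped spanned by them: the normalized Haar measure dominates Lebesgue measure in these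
coordinates.
-/

open Topology

noncomputable section

section CrossPolytope

variable {ι : Type*} [Fintype ι]

theorem volume_crossPolytope :
    volume {x : ι → ℝ | ∑ i, ‖x i‖ₑ ≤ 1} =
      (2 : ℝ≥0∞) ^ Fintype.card ι / ((Fintype.card ι).factorial : ℝ≥0∞) := by
  have habs (x : ι → ℝ) : ∑ i, ‖x i‖ₑ ≤ 1 ↔ ∑ i, |x i| ≤ 1 := by
    simp only [Real.enorm_eq_ofReal_abs]
    rw [← ENNReal.ofReal_sum_of_nonneg fun i _ => abs_nonneg (x i), ENNReal.ofReal_le_one]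
  simp only [habs]
  rcases isEmpty_or_nonempty ι with h | h
  · simp [volume_pi]
  · have hball := volume_sum_rpow_le ι (p := 1) le_rfl 1
    simp only [Real.rpow_one, div_one, ENNReal.ofReal_one, one_pow, one_mul, one_add_one_eq_two,
      Real.Gamma_two, mul_one, Real.Gamma_nat_eq_factorial] at hball
    rw [hball, ENNReal.ofReal_div_of_pos (by positivity)]
    simp

theorem volume_weighted_crossPolytope_mul_prod (w : ι → ℝ≥0∞) (hw₀ : ∀ i, w i ≠ 0)
    (hw : ∀ i, w i ≠ ⊤) :
    volume {x : ι → ℝ | ∑ i, ‖x i‖ₑ * w i ≤ 1} * ∏ i, w i =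
      (2 : ℝ≥0∞) ^ Fintype.card ι / ((Fintype.card ι).factorial : ℝ≥0∞) := by
  classical
  let D : (ι → ℝ) →ₗ[ℝ] ι → ℝ := Matrix.toLin' (Matrix.diagonal fun i => (w i).toReal)
  have hdet : LinearMap.det D = (∏ i, w i).toReal := by
    rw [LinearMap.det_toLin', Matrix.det_diagonal, ENNReal.toReal_prod]
  have hprod₀ : ∏ i, w i ≠ 0 := Finset.prod_ne_zero_iff.2 fun i _ => hw₀ i
  have hprod : ∏ i, w i ≠ ⊤ := ENNReal.prod_ne_top fun i _ => hw i
  have hpos : 0 < (∏ i, w i).toReal := ENNReal.toReal_pos hprod₀ hprod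
  have hpre : {x : ι → ℝ | ∑ i, ‖x i‖ₑ * w i ≤ 1} = D ⁻¹' {x | ∑ i, ‖x i‖ₑ ≤ 1} := by
    ext x
    simp [D, Matrix.mulVec_diagonal, enorm_mul, mul_comm, Real.enorm_of_nonneg, hw]
  rw [hpre, Measure.addHaar_preimage_linearMap _ (hdet ▸ hpos.ne'), volume_crossPolytope, hdet,
    abs_of_pos (inv_pos.2 hpos), ENNReal.ofReal_inv_of_pos hpos, ENNReal.ofReal_toReal hprod,
    mul_right_comm, ENNReal.inv_mul_cancel hprod₀ hprod, one_mul]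

end CrossPolytope

section Covolume

theorem addCovolume_le_measure_of_subgroup {G α : Type*} [AddGroup G] [AddAction G α]
    [MeasurableSpace α] [MeasurableConstVAdd G α] {μ : Measure α} [VAddInvariantMeasure G α μ]
    {H K : AddSubgroup G} [Countable H] (hHK : H ≤ K) {s : Set α}
    (hs : IsAddFundamentalDomain H s μ) : addCovolume K α μ ≤ μ s := by
  by_cases hK : HasAddFundamentalDomain K α μ
  · rw [addCovolume, dif_pos hK]
    have ht := hK.ExistsIsAddFundamentalDomain.choose_spec
    refine hs.measure_le_of_pairwise_disjoint ht.nullMeasurableSet fun g g' hne => ?_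
    exact (ht.aedisjoint ((AddSubgroup.inclusion_injective hHK).ne hne)).mono
      inter_subset_left inter_subset_left
  · simp [addCovolume, hK]

variable {V : Type*} [AddCommGroup V] [Module ℝ V] [TopologicalSpace V] [IsTopologicalAddGroup V]
  [ContinuousSMul ℝ V] [T2Space V] [MeasurableSpace V] [BorelSpace V]

theorem isAddFundamentalDomain_preimage_equivFunL {ι : Type*} [Finite ι]
    (b : Module.Basis ι ℝ V) (μ : Measure V) :
    IsAddFundamentalDomain (Submodule.span ℤ (range b)).toAddSubgroup
      (b.equivFunL ⁻¹' univ.pi fun _ => Ico (0 : ℝ) 1) μ := by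
  cases nonempty_fintype ι
  have hspan (v : V) : v ∈ Submodule.span ℤ (range b) ↔
      b.equivFunL v ∈ Submodule.span ℤ (range (Pi.basisFun ℝ ι)) := by
    simp [Module.Basis.mem_span_iff_repr_mem]
  rw [← ZSpan.fundamentalDomain_pi_basisFun]
  refine .mk' ((ZSpan.fundamentalDomain_measurableSet _).preimage
    b.equivFunL.continuous.measurable).nullMeasurableSet fun x => ?_
  obtain ⟨g, hg, hunique⟩ :=
    ZSpan.exist_unique_vadd_mem_fundamentalDomain (Pi.basisFun ℝ ι) (b.equivFunL x)
  refine ⟨⟨b.equivFunL.symm g, (hspan _).2 (by simp)⟩, ?_, fun v hv => Subtype.ext ?_⟩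
  · simpa [Submodule.vadd_def, AddSubgroup.vadd_def] using hg
  · rw [ContinuousLinearEquiv.eq_symm_apply]
    refine congrArg Subtype.val (hunique ⟨b.equivFunL v, (hspan _).1 v.2⟩ ?_)
    simpa [Submodule.vadd_def, AddSubgroup.vadd_def] using hv

theorem addCovolume_le_measure_preimage_equivFunL {ι : Type*} [Finite ι]
    (b : Module.Basis ι ℝ V) {Λ : AddSubgroup V} (hΛ : ∀ i, b i ∈ Λ) (μ : Measure V)
    [μ.IsAddLeftInvariant] :
    addCovolume Λ V μ ≤ μ (b.equivFunL ⁻¹' univ.pi fun _ => Ico (0 : ℝ) 1) := by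
  have hspan : Submodule.span ℤ (range b) ≤ Λ.toIntSubmodule :=
    Submodule.span_le.2 (range_subset_iff.2 hΛ)
  have : Countable (Submodule.span ℤ (range b)).toAddSubgroup :=
    inferInstanceAs (Countable (Submodule.span ℤ (range b)))
  exact addCovolume_le_measure_of_subgroup hspan (isAddFundamentalDomain_preimage_equivFunL b μ)

theorem volume_le_inv_addCovolume_smul {ι : Type*} [Fintype ι] (b : Module.Basis ι ℝ V)
    {Λ : AddSubgroup V} (hΛ : ∀ i, b i ∈ Λ) (μ : Measure V) [μ.IsAddHaarMeasure] (s : Set (ι → ℝ)) :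
    volume s ≤ ((addCovolume Λ V μ)⁻¹ • μ) (b.equivFunL ⁻¹' s) := by
  have hHaar : (μ.map b.equivFunL).IsAddHaarMeasure := b.equivFunL.isAddHaarMeasure_map μ
  let cube : TopologicalSpace.PositiveCompacts (ι → ℝ) := .piIcc01 ι
  let c : ℝ≥0∞ := μ.map b.equivFunL cube
  have hc₀ : c ≠ 0 := (Measure.measure_pos_of_nonempty_interior _ cube.interior_nonempty).ne'
  have hc : c ≠ ⊤ := cube.isCompact.measure_ne_top
  have hmap (t : Set (ι → ℝ)) : μ (b.equivFunL ⁻¹' t) = c * volume t := by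
    calc μ (b.equivFunL ⁻¹' t) = μ.map b.equivFunL t :=
          (b.equivFunL.toHomeomorph.toMeasurableEquiv.map_apply t).symm
      _ = c * volume t := by
          rw [Measure.addHaarMeasure_unique (μ.map b.equivFunL) cube, addHaarMeasure_eq_volume_pi]
          rfl
  have hcovol : addCovolume Λ V μ ≤ c :=
    (addCovolume_le_measure_preimage_equivFunL b hΛ μ).trans_eq (by simp [hmap, volume_pi_pi])
  calc volume s = c⁻¹ * (c * volume s) := (ENNReal.inv_mul_cancel_left hc₀ hc).symm
    _ ≤ (addCovolume Λ V μ)⁻¹ * μ (b.equivFunL ⁻¹' s) := by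
        rw [hmap]
        gcongr
    _ = ((addCovolume Λ V μ)⁻¹ • μ) (b.equivFunL ⁻¹' s) := rfl

end Covolume

section HomologyHaar

theorem t2Space_of_basis {ι R V : Type*} [Semiring R] [TopologicalSpace R]
    [IsTopologicalSemiring R] [T2Space R] [AddCommMonoid V] [Module R V] [TopologicalSpace V]
    [IsModuleTopology R V] (b : Module.Basis ι R V) : T2Space V :=
  let coords : V →ₗ[R] ι → R := LinearMap.pi b.coord
  .of_injective_continuous (f := coords) (fun _ _ h => b.ext_elem (congrFun h))
    (IsModuleTopology.continuous_of_linearMap coords)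

theorem isAddHaarMeasure_homologyHaar (M : Type*) [TopologicalSpace M]
    [LocallyCompactSpace (SingularH₁ ℝ M)] : (homologyHaar M).IsAddHaarMeasure := by
  have h : Nonempty (TopologicalSpace.PositiveCompacts (SingularH₁ ℝ M)) := inferInstance
  rw [homologyHaar, dif_pos h]
  infer_instance

theorem volume_le_latticeHaar {M : Type*} [TopologicalSpace M] {ι : Type*} [Fintype ι]
    [T2Space (SingularH₁ ℝ M)] (b : Module.Basis ι ℝ (SingularH₁ ℝ M))
    (hb : ∀ k, b k ∈ integerLattice M) (s : Set (ι → ℝ)) :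
    volume s ≤ latticeHaar M (b.equivFunL ⁻¹' s) := by
  have : LocallyCompactSpace (SingularH₁ ℝ M) :=
    b.equivFunL.toHomeomorph.isClosedEmbedding.locallyCompactSpace
  have := isAddHaarMeasure_homologyHaar M
  exact volume_le_inv_addCovolume_smul b hb (homologyHaar M) s

end HomologyHaar

section StableNorm

variable {M : Type*} [PseudoEMetricSpace M]

/-- The mass `∑ |rᵢ| ℓ(σᵢ)` of a real `1`-chain `∑ rᵢ σᵢ`, the quantity minimized by the stable
norm. -/
def chainMass (c : SingularChain ℝ M 1) : ℝ≥0∞ :=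
  c.sum fun σ r => ‖r‖ₑ * simplexLength σ

/-- The space of real Lipschitz `1`-chains, as the chains supported on Lipschitz simplices. -/
def lipschitzChains₁ (M : Type*) [PseudoEMetricSpace M] : Submodule ℝ (SingularChain ℝ M 1) :=
  Finsupp.supported ℝ ℝ {σ | ∃ K : ℝ≥0, LipschitzWith K σ}

/-- The Lipschitz `1`-cycles representing a homology class: the competitors in the infimum that
defines its stable norm. -/
def LipschitzRepresentative (h : SingularH₁ ℝ M) : Type _ :=
  {c : SingularCycle₁ ℝ M //
    SingularCycle₁.chain ℝ M c ∈ lipschitzChains₁ M ∧ singularClass ℝ M c = h}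

theorem chainMass_single (σ : SingularSimplex M 1) (r : ℝ) :
    chainMass (Finsupp.single σ r) = ‖r‖ₑ * simplexLength σ :=
  Finsupp.sum_single_index (by simp)

theorem chainMass_eq_tsum (c : SingularChain ℝ M 1) :
    chainMass c = ∑' σ, ‖c σ‖ₑ * simplexLength σ :=
  (tsum_eq_sum fun σ hσ => by simp [Finsupp.notMem_support_iff.1 hσ]).symm

theorem chainMass_add_le (c c' : SingularChain ℝ M 1) :
    chainMass (c + c') ≤ chainMass c + chainMass c' := by
  simp only [chainMass_eq_tsum, ← ENNReal.tsum_add, ← add_mul]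
  gcongr
  exact enorm_add_le _ _

theorem chainMass_smul (a : ℝ) (c : SingularChain ℝ M 1) :
    chainMass (a • c) = ‖a‖ₑ * chainMass c := by
  simp only [chainMass_eq_tsum, ← ENNReal.tsum_mul_left, Finsupp.smul_apply, smul_eq_mul, enorm_mul,
    mul_assoc]

theorem stableNorm_eq_iInf (h : SingularH₁ ℝ M) :
    stableNorm h = ⨅ c : LipschitzRepresentative h, chainMass (SingularCycle₁.chain ℝ M c.1) := by
  simp only [LipschitzRepresentative, iInf_subtype, iInf_and]
  rfl

theorem stableNorm_singularClass_le {c : SingularCycle₁ ℝ M}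
    (hc : SingularCycle₁.chain ℝ M c ∈ lipschitzChains₁ M) :
    stableNorm (singularClass ℝ M c) ≤ chainMass (SingularCycle₁.chain ℝ M c) :=
  (stableNorm_eq_iInf _).trans_le (iInf_le_of_le ⟨c, hc, rfl⟩ le_rfl)

theorem stableNorm_zero : stableNorm (0 : SingularH₁ ℝ M) = 0 := by
  simpa [chainMass] using stableNorm_singularClass_le (M := M) (c := 0) (by simp)

theorem stableNorm_add_le (h h' : SingularH₁ ℝ M) :
    stableNorm (h + h') ≤ stableNorm h + stableNorm h' := by
  rw [stableNorm_eq_iInf h, stableNorm_eq_iInf h']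
  refine ENNReal.le_iInf_add_iInf ?_
  rintro ⟨c, hc, rfl⟩ ⟨c', hc', rfl⟩
  rw [← map_add]
  refine (stableNorm_singularClass_le ?_).trans ?_ <;> rw [map_add]
  · exact add_mem hc hc'
  · exact chainMass_add_le _ _

theorem stableNorm_smul_le (a : ℝ) (h : SingularH₁ ℝ M) :
    stableNorm (a • h) ≤ ‖a‖ₑ * stableNorm h := by
  rcases eq_or_ne a 0 with rfl | ha
  · simp [stableNorm_zero]
  rw [stableNorm_eq_iInf h, ENNReal.mul_iInf_of_ne (enorm_ne_zero.2 ha) enorm_ne_top]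
  refine le_iInf ?_
  rintro ⟨c, hc, rfl⟩
  rw [← map_smul, ← chainMass_smul, ← map_smul]
  exact stableNorm_singularClass_le (by rw [map_smul]; exact Submodule.smul_mem _ a hc)

theorem stableNorm_sum_smul_le {ι : Type*} (s : Finset ι) (a : ι → ℝ) (h : ι → SingularH₁ ℝ M) :
    stableNorm (∑ k ∈ s, a k • h k) ≤ ∑ k ∈ s, ‖a k‖ₑ * stableNorm (h k) :=
  (Finset.le_sum_of_subadditive stableNorm stableNorm_zero.le stableNorm_add_le _ _).trans
    (Finset.sum_le_sum fun k _ => stableNorm_smul_le (a k) (h k))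

theorem preimage_crossPolytope_subset_stableBall {ι : Type*} [Fintype ι]
    [T2Space (SingularH₁ ℝ M)] (b : Module.Basis ι ℝ (SingularH₁ ℝ M)) {ℓ : ι → ℝ≥0∞}
    (hb : ∀ k, stableNorm (b k) ≤ ℓ k) :
    b.equivFunL ⁻¹' {x | ∑ k, ‖x k‖ₑ * ℓ k ≤ 1} ⊆ stableBall M := by
  intro h hh
  calc stableNorm h = stableNorm (∑ k, b.equivFunL h k • b k) :=
        congrArg stableNorm (b.sum_equivFun h).symm
    _ ≤ ∑ k, ‖b.equivFunL h k‖ₑ * stableNorm (b k) := stableNorm_sum_smul_le _ _ _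
    _ ≤ ∑ k, ‖b.equivFunL h k‖ₑ * ℓ k := by gcongr with k; exact hb k
    _ ≤ 1 := hh

theorem two_pow_div_factorial_le_latticeHaar_stableBall_mul_prod {ι : Type*} [Fintype ι]
    (b : Module.Basis ι ℝ (SingularH₁ ℝ M)) (hb : ∀ k, b k ∈ integerLattice M) {ℓ : ι → ℝ≥0∞}
    (hbℓ : ∀ k, stableNorm (b k) ≤ ℓ k) (hℓ₀ : ∀ k, ℓ k ≠ 0) (hℓ : ∀ k, ℓ k ≠ ⊤) :
    (2 : ℝ≥0∞) ^ Fintype.card ι / ((Fintype.card ι).factorial : ℝ≥0∞) ≤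
      latticeHaar M (stableBall M) * ∏ k, ℓ k := by
  have := t2Space_of_basis b
  rw [← volume_weighted_crossPolytope_mul_prod ℓ hℓ₀ hℓ]
  gcongr
  exact (volume_le_latticeHaar b hb _).trans
    (measure_mono (preimage_crossPolytope_subset_stableBall b hbℓ))

end StableNorm

theorem lipschitzWith_of_forall_exists_lipschitzOnWith {E : Type*} [PseudoEMetricSpace E]
    {f : ℝ → E} {K : ℝ≥0} (hf : ∀ t, ∃ s ∈ 𝓝 t, LipschitzOnWith K f s) : LipschitzWith K f := by
  have hcont : Continuous f := LocallyLipschitz.continuous fun t => ⟨K, hf t⟩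
  have hle : ∀ a b, a ≤ b → edist (f a) (f b) ≤ K * edist a b := by
    intro a b hab
    let s : Set ℝ := {t | edist (f a) (f t) ≤ K * edist a t}
    have hs : IsClosed s := isClosed_le (by fun_prop)
      ((ENNReal.continuous_const_mul ENNReal.coe_ne_top).comp (by fun_prop))
    refine (hs.inter isClosed_Icc).Icc_subset_of_forall_mem_nhdsWithin (a := a) (b := b)
      (by simp [s]) ?_ ⟨hab, le_rfl⟩
    rintro x ⟨hx, hax, -⟩
    obtain ⟨u, hu, hfu⟩ := hf x
    filter_upwards [self_mem_nhdsWithin, mem_nhdsWithin_of_mem_nhds hu] with y hxy hy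
    have hadd : edist a x + edist x y = edist a y := by
      rw [edist_dist, edist_dist, edist_dist, ← ENNReal.ofReal_add dist_nonneg dist_nonneg,
        dist_add_dist_of_mem_segment (Icc_subset_segment ⟨hax, le_of_lt hxy⟩)]
    calc edist (f a) (f y) ≤ edist (f a) (f x) + edist (f x) (f y) := edist_triangle ..
      _ ≤ K * edist a x + K * edist x y := add_le_add hx (hfu (mem_of_mem_nhds hu) hy)
      _ = K * edist a y := by rw [← mul_add, hadd]
  intro a b
  rcases le_total a b with hab | hab
  · exact hle a b hab
  · simpa only [edist_comm] using hle b a hab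

namespace ClosedGeodesic

variable {M : Type*} [PseudoEMetricSpace M] (γ : ClosedGeodesic M)

theorem exists_lipschitzWith : ∃ K : ℝ≥0, LipschitzWith K γ.curve := by
  obtain ⟨v, hv, hmin⟩ := γ.locally_minimizing
  refine ⟨v.toNNReal, lipschitzWith_of_forall_exists_lipschitzOnWith fun t => ?_⟩
  obtain ⟨ε, hε, hdist⟩ := hmin t
  refine ⟨Ioo (t - ε) (t + ε), Ioo_mem_nhds (by linarith) (by linarith), fun s hs s' hs' => ?_⟩
  rw [hdist s hs s' hs', ENNReal.ofReal_mul hv.le, edist_dist, Real.dist_eq]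
  rfl

theorem length_ne_top : γ.length ≠ ⊤ := by
  obtain ⟨K, hK⟩ := γ.exists_lipschitzWith
  simpa [BoundedVariationOn, length] using
    hK.locallyBoundedVariationOn univ 0 1 (mem_univ _) (mem_univ _)

theorem length_ne_zero : γ.length ≠ 0 := by
  obtain ⟨v, hv, hmin⟩ := γ.locally_minimizing
  obtain ⟨ε, hε, hdist⟩ := hmin 0
  obtain ⟨δ, hδ, hδε⟩ : ∃ δ, 0 < δ ∧ δ < min ε 1 := exists_between (by positivity)
  obtain ⟨hδε, hδ₁⟩ := lt_min_iff.1 hδε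
  have hpos : 0 < edist (γ.curve 0) (γ.curve δ) := by
    rw [hdist 0 ⟨by linarith, by linarith⟩ δ ⟨by linarith, by linarith⟩, ENNReal.ofReal_pos,
      zero_sub, abs_neg]
    positivity
  have hle : edist (γ.curve 0) (γ.curve δ) ≤ γ.length :=
    eVariationOn.edist_le γ.curve ⟨le_rfl, zero_le_one⟩ ⟨hδ.le, hδ₁.le⟩
  exact (hpos.trans_le hle).ne'

theorem exists_lipschitzWith_simplex : ∃ K : ℝ≥0, LipschitzWith K γ.simplex := by
  obtain ⟨K, hK⟩ := γ.exists_lipschitzWith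
  exact ⟨K * (1 * 1), hK.comp <|
    (LipschitzWith.eval (α := fun _ : Fin 2 => ℝ) 1).comp (LipschitzWith.subtype_val _)⟩

theorem simplexLength_simplex_le : simplexLength γ.simplex ≤ γ.length :=
  eVariationOn.comp_le_of_monotoneOn γ.curve (fun t : unitInterval => (t : ℝ))
    (fun _ _ _ _ h => h) (fun t _ => t.2)

theorem stableNorm_homologyClass_le : stableNorm γ.homologyClass ≤ γ.length := by
  have hLip : Finsupp.single γ.simplex (1 : ℝ) ∈ lipschitzChains₁ M :=
    Finsupp.single_mem_supported ℝ 1 γ.exists_lipschitzWith_simplex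
  calc stableNorm γ.homologyClass ≤ chainMass (Finsupp.single γ.simplex 1) :=
        stableNorm_singularClass_le hLip
    _ = simplexLength γ.simplex := by rw [chainMass_single, enorm_one, one_mul]
    _ ≤ γ.length := γ.simplexLength_simplex_le

theorem homologyClass_mem_integerLattice : γ.homologyClass ∈ integerLattice M := by
  refine ⟨singularClass ℤ M ⟨Finsupp.single γ.simplex 1, γ.single_mem_cycles ℤ⟩,
    congrArg (singularClass ℝ M) (Subtype.ext ?_)⟩
  change Finsupp.mapRange _ (map_zero _) (Finsupp.single γ.simplex (1 : ℤ)) = _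
  simp

end ClosedGeodesic

end

theorem mainTheorem12_general {M : Type*} [PseudoEMetricSpace M] {ι : Type*} [Fintype ι]
    (γ : ι → ClosedGeodesic M) (hli : LinearIndependent ℝ fun k => (γ k).homologyClass)
    (hspan : Submodule.span ℝ (Set.range fun k => (γ k).homologyClass) = ⊤) :
    (2 : ℝ≥0∞) ^ Fintype.card ι / ((Fintype.card ι).factorial : ℝ≥0∞) ≤
      latticeHaar M (stableBall M) * ∏ k, (γ k).length := by
  let b : Module.Basis ι ℝ (SingularH₁ ℝ M) := .mk hli hspan.ge
  have hb (k : ι) : b k = (γ k).homologyClass := Module.Basis.mk_apply hli hspan.ge k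
  exact two_pow_div_factorial_le_latticeHaar_stableBall_mul_prod b
    (fun k => hb k ▸ (γ k).homologyClass_mem_integerLattice)
    (fun k => hb k ▸ (γ k).stableNorm_homologyClass_le)
    (fun k => (γ k).length_ne_zero) (fun k => (γ k).length_ne_top)

theorem mainTheorem12 {n : ℕ} {M : Type*} [EMetricSpace M]
    [ChartedSpace (EuclideanSpace ℝ (Fin n)) M] [IsManifold (𝓡 n) ∞ M]
    [Bundle.RiemannianBundle (fun x : M => TangentSpace (𝓡 n) x)]
    [IsContMDiffRiemannianBundle (𝓡 n) ∞ (EuclideanSpace ℝ (Fin n))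
      (fun x : M => TangentSpace (𝓡 n) x)]
    [IsRiemannianManifold (𝓡 n) M] [CompactSpace M] [ConnectedSpace M]
    {d : ℕ} (γ : Fin d → ClosedGeodesic M)
    (hli : LinearIndependent ℝ fun k => (γ k).homologyClass)
    (hspan : Submodule.span ℝ (Set.range fun k => (γ k).homologyClass) = ⊤) :
    (2 : ℝ≥0∞) ^ d / (d.factorial : ℝ≥0∞) ≤
      latticeHaar M (stableBall M) * ∏ k, (γ k).length := by
  simpa only [Fintype.card_fin] using mainTheorem12_general γ hli hspan
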